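/- Let $k\ge 0$ be an integer. Partitions are identified with their diagrams, $\mu\subseteq\lambda$ means $\mu_i\le\lambda_i$ for all $i$, and a partition is $k$-bounded if all its parts are at most $k$. In a skew diagram $\gamma/\rho$ with rows numbered from bottom to top, the hook-length of a square $(i,j)\in\gamma$ (possibly in $\rho$) is the number of cells of $\gamma/\rho$ that lie in row $i$ weakly to the right of $(i,j)$ or in column $j$ weakly above it. The $k$-skew diagram of a $k$-bounded partition $\lambda$ is the unique skew diagram $\gamma/\rho$ whose row $i$ has length $\lambda_i$ for every $i$, all of whose cells have hook-length at most $k$, and such that every square of $\rho$ has hook-length greater than $k$. Its column lengths form a $k$-bounded partition, the $k$-conjugate $\lambda^{\omega_k}$. The $k$-Young lattice $Y^k$ is the set of $k$-bounded partitions with the partial order $\preceq$ defined as the reflexive and transitive closure of the relation $$\mu\prec\!\!\cdot\,\lambda\quad\Longleftrightarrow\quad \mu\subseteq\lambda,\ \ \mu^{\omega_k}\subseteq\lambda^{\omega_k}\ \text{ and }\ |\lambda|-|\mu|=1 .$$ Write $\mu<\!\!\cdot\,\lambda$ if $\mu\subseteq\lambda$ and $|\lambda|-|\mu|=1$; this is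 the covering relation of the Young lattice $Y$ of all partitions ordered by inclusion. For integers $0\le m\le k$ and $n\ge 0$ let $(m^n)$ be the partition with $n$ parts equal to $m$ (empty if $m=0$ or $n=0$), let $L(m,n)=\{\mu:\mu\subseteq(m^n)\}$, ordered by inclusion, and let $L^k(m,n)=\{\mu\in Y^k:\mu\preceq(m^n)\}$, ordered by $\preceq$. **Theorem.** Let $0\le m\le k$ and $n\ge 0$. 1. For all $\lambda,\mu\in L^k(m,n)$: $\ \mu\preceq\lambda\iff\mu\subseteq\lambda$. 2. Every partition in $L^k(m,n)$ lies in $L(m,n)$, and the identity map on partitions is an isomorphism from the poset $L^k(m,n)$ onto the subposet of $L(m,n)$ induced on the partitions that belong to $L^k(m,n)$. 3. For all $\lambda,\mu\in L^k(m,n)$: $\ \mu\prec\!\!\cdot\,\lambda\iff\mu<\!\!\cdot\,\lambda$. Moreover, $\lambda$ covers $\mu$ in the poset $L^k(m,n)$ if and only if $\lambda$ covers $\mu$ in the Young lattice. -/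

import Mathlib

/-! Integer partitions are Mathlib's `YoungDiagram`s: `μ.rowLen i` is the part with index `i`
(counted from `0`), `μ ≤ ν` is inclusion of diagrams, `μ.card` is the degree.  A cell is a pair
(row, column).  Rows with larger index lie higher. -/

namespace KYoung

/-- A skew shape `outer / inner`. -/
structure SkewShape where
  outer : YoungDiagram
  inner : YoungDiagram
  inner_le : inner ≤ outer

namespace SkewShape

/-- The cells of the skew shape; the elements of `D.inner` are the squares below `D`. -/
def cells (D : SkewShape) : Finset (ℕ × ℕ) := D.outer.cells \ D.inner.cells

/-- The length of row `i`. -/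
def rowLen (D : SkewShape) (i : ℕ) : ℕ := (D.cells.filter fun c => c.1 = i).card

/-- The length of column `j`. -/
def colLen (D : SkewShape) (j : ℕ) : ℕ := (D.cells.filter fun c => c.2 = j).card

/-- The hook of a square `s`: the cells of `D` lying in the L with corner `s`, that is, in the row
of `s` weakly to its right or in the column of `s` weakly above it. -/
def hook (D : SkewShape) (s : ℕ × ℕ) : Finset (ℕ × ℕ) :=
  D.cells.filter fun c => (c.1 = s.1 ∧ s.2 ≤ c.2) ∨ (c.2 = s.2 ∧ s.1 ≤ c.1)

/-- The hook-length of a square. -/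
def hookLength (D : SkewShape) (s : ℕ × ℕ) : ℕ := (D.hook s).card

end SkewShape

/-- A `k`-bounded partition: every part is at most `k`. -/
@[ext]
structure KBounded (k : ℕ) where
  diagram : YoungDiagram
  bounded : diagram.rowLen 0 ≤ k

/-- `D` is a `k`-skew diagram of the partition `lam`. -/
structure IsKSkew (k : ℕ) (lam : YoungDiagram) (D : SkewShape) : Prop where
  rowLen_eq : ∀ i, D.rowLen i = lam.rowLen i
  hook_le : ∀ s ∈ D.cells, D.hookLength s ≤ k
  lt_hook : ∀ s ∈ D.inner, k < D.hookLength s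

/-! Existence and uniqueness of the `k`-skew diagram. -/

theorem SkewShape.mem_cells_iff (D : SkewShape) (i j : ℕ) :
    (i, j) ∈ D.cells ↔ D.inner.rowLen i ≤ j ∧ j < D.outer.rowLen i := by
  simp only [SkewShape.cells, Finset.mem_sdiff, YoungDiagram.mem_cells,
    YoungDiagram.mem_iff_lt_rowLen]
  omega

theorem SkewShape.inner_rowLen_le (D : SkewShape) (i : ℕ) :
    D.inner.rowLen i ≤ D.outer.rowLen i := by
  by_contra h
  push Not at h
  have h1 : (i, D.outer.rowLen i) ∈ D.inner := YoungDiagram.mem_iff_lt_rowLen.2 h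
  have h2 := YoungDiagram.mem_iff_lt_rowLen.1 (D.inner_le h1)
  exact lt_irrefl _ h2

theorem SkewShape.rowLen_eq_sub (D : SkewShape) (i : ℕ) :
    D.rowLen i = D.outer.rowLen i - D.inner.rowLen i := by
  have : (D.cells.filter fun c => c.1 = i) =
      (Finset.Ico (D.inner.rowLen i) (D.outer.rowLen i)).image (fun j => (i, j)) := by
    ext ⟨a, b⟩
    simp only [Finset.mem_filter, SkewShape.mem_cells_iff, Finset.mem_image, Finset.mem_Ico,
      Prod.mk.injEq]
    constructor
    · rintro ⟨h, rfl⟩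
      exact ⟨b, h, rfl, rfl⟩
    · rintro ⟨j, h, rfl, rfl⟩
      exact ⟨h, rfl⟩
  rw [SkewShape.rowLen, this, Finset.card_image_of_injective _ (Prod.mk_right_injective i),
    Nat.card_Ico]

/-- The number of cells in column `j` and in rows of index at least `i`. -/
def SkewShape.colAbove (D : SkewShape) (i j : ℕ) : ℕ :=
  (D.cells.filter fun c => c.2 = j ∧ i ≤ c.1).card

theorem SkewShape.hookLength_eq (D : SkewShape) (i j : ℕ) :
    D.hookLength (i, j) =
      (D.outer.rowLen i - max j (D.inner.rowLen i)) + D.colAbove (i + 1) j := by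
  have h1 : D.hook (i, j) =
      (Finset.Ico (max j (D.inner.rowLen i)) (D.outer.rowLen i)).image (fun j => (i, j)) ∪
        (D.cells.filter fun c => c.2 = j ∧ i + 1 ≤ c.1) := by
    ext ⟨a, b⟩
    simp only [SkewShape.hook, Finset.mem_filter, Finset.mem_union, SkewShape.mem_cells_iff,
      Finset.mem_image, Finset.mem_Ico, Prod.mk.injEq, max_le_iff]
    constructor
    · rintro ⟨h, ⟨rfl, h2⟩ | ⟨rfl, h2⟩⟩
      · exact Or.inl ⟨b, ⟨⟨h2, h.1⟩, h.2⟩, rfl, rfl⟩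
      · rcases Nat.eq_or_lt_of_le h2 with h3 | h3
        · subst h3
          exact Or.inl ⟨b, ⟨⟨le_rfl, h.1⟩, h.2⟩, rfl, rfl⟩
        · exact Or.inr ⟨h, rfl, h3⟩
    · rintro (⟨x, ⟨⟨h1, h2⟩, h3⟩, rfl, rfl⟩ | ⟨h, rfl, h2⟩)
      · exact ⟨⟨h2, h3⟩, Or.inl ⟨rfl, h1⟩⟩
      · exact ⟨h, Or.inr ⟨rfl, by omega⟩⟩
  rw [SkewShape.hookLength, h1, Finset.card_union_of_disjoint,
    Finset.card_image_of_injective _ (Prod.mk_right_injective i), Nat.card_Ico]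
  · rfl
  · rw [Finset.disjoint_left]
    rintro ⟨a, b⟩ h2 h3
    simp only [Finset.mem_image, Finset.mem_filter, Prod.mk.injEq] at h2 h3
    obtain ⟨x, -, rfl, -⟩ := h2
    omega

theorem SkewShape.colAbove_succ (D : SkewShape) (i j : ℕ) :
    D.colAbove i j = D.colAbove (i + 1) j +
      if D.inner.rowLen i ≤ j ∧ j < D.outer.rowLen i then 1 else 0 := by
  have h1 : (D.cells.filter fun c => c.2 = j ∧ i ≤ c.1) =
      (D.cells.filter fun c => c.2 = j ∧ i + 1 ≤ c.1) ∪
        (if D.inner.rowLen i ≤ j ∧ j < D.outer.rowLen i then {(i, j)} else ∅) := by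
    ext ⟨a, b⟩
    split_ifs with h
    · simp only [Finset.mem_filter, Finset.mem_union, SkewShape.mem_cells_iff,
        Finset.mem_singleton, Prod.mk.injEq]
      constructor
      · rintro ⟨h1, rfl, h2⟩
        by_cases h3 : a = i
        · exact Or.inr ⟨h3, rfl⟩
        · exact Or.inl ⟨h1, rfl, by omega⟩
      · rintro (⟨h1, rfl, h2⟩ | ⟨rfl, rfl⟩)
        · exact ⟨h1, rfl, by omega⟩
        · exact ⟨h, rfl, le_rfl⟩
    · simp only [Finset.mem_filter, Finset.mem_union, SkewShape.mem_cells_iff,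
        Finset.notMem_empty, or_false]
      constructor
      · rintro ⟨h1, rfl, h2⟩
        refine ⟨h1, rfl, ?_⟩
        by_contra h3
        have : a = i := by omega
        subst this
        exact h h1
      · rintro ⟨h1, rfl, h2⟩
        exact ⟨h1, rfl, by omega⟩
  rw [SkewShape.colAbove, h1, Finset.card_union_of_disjoint]
  · rw [SkewShape.colAbove]
    split_ifs <;> simp
  · split_ifs
    · simp
    · simp

theorem SkewShape.colLen_eq_colAbove (D : SkewShape) (j : ℕ) : D.colLen j = D.colAbove 0 j := by
  simp [SkewShape.colLen, SkewShape.colAbove]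

theorem YD_rowLen_eq_zero (μ : YoungDiagram) {i : ℕ} (h : μ.colLen 0 ≤ i) : μ.rowLen i = 0 := by
  by_contra h1
  have h2 : (i, 0) ∈ μ := YoungDiagram.mem_iff_lt_rowLen.2 (by omega)
  have h3 := YoungDiagram.mem_iff_lt_colLen.1 h2
  omega

theorem YD_ext_rowLen {μ ν : YoungDiagram} (h : ∀ i, μ.rowLen i = ν.rowLen i) : μ = ν := by
  ext ⟨i, j⟩
  simp only [YoungDiagram.mem_cells, YoungDiagram.mem_iff_lt_rowLen, h]

theorem SkewShape.colAbove_eq_zero (D : SkewShape) {i : ℕ} (h : D.outer.colLen 0 ≤ i) (j : ℕ) :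
    D.colAbove i j = 0 := by
  rw [SkewShape.colAbove, Finset.card_eq_zero, Finset.filter_eq_empty_iff]
  rintro ⟨a, b⟩ h1 ⟨-, h2⟩
  rw [SkewShape.mem_cells_iff] at h1
  have h3 : D.outer.rowLen a = 0 := YD_rowLen_eq_zero D.outer (h.trans h2)
  omega

/-- A recursion in the rows that determines the numbers of cells in the columns. -/
theorem SkewShape.colAbove_eq (D : SkewShape) (r l : ℕ → ℕ) (C : ℕ → ℕ → ℕ) (t : ℕ)
    (hr : ∀ i, D.inner.rowLen i = r i) (hl : ∀ i, D.outer.rowLen i = r i + l i)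
    (h0 : ∀ i, t ≤ i → ∀ j, C i j = 0)
    (hC : ∀ i j, C i j = C (i + 1) j + if r i ≤ j ∧ j < r i + l i then 1 else 0) (i j : ℕ) :
    D.colAbove i j = C i j := by
  have key : ∀ n i, max t (D.outer.colLen 0) ≤ i + n → D.colAbove i j = C i j := by
    intro n
    induction n with
    | zero =>
      intro i hi
      rw [h0 i (by omega), D.colAbove_eq_zero (by omega)]
    | succ n ih =>
      intro i hi
      rw [D.colAbove_succ, hC, ih (i + 1) (by omega), hr, hl]
  exact key _ i (Nat.le_add_left _ _)

theorem IsKSkew.unique {k : ℕ} {lam : YoungDiagram} {D E : SkewShape} (hD : IsKSkew k lam D)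
    (hE : IsKSkew k lam E) : D = E := by
  have oD : ∀ i, D.outer.rowLen i = D.inner.rowLen i + lam.rowLen i := fun i => by
    have := D.inner_rowLen_le i
    have := hD.rowLen_eq i
    rw [D.rowLen_eq_sub] at this
    omega
  have oE : ∀ i, E.outer.rowLen i = E.inner.rowLen i + lam.rowLen i := fun i => by
    have := E.inner_rowLen_le i
    have := hE.rowLen_eq i
    rw [E.rowLen_eq_sub] at this
    omega
  have aux : ∀ (D E : SkewShape), IsKSkew k lam D → IsKSkew k lam E →
      (∀ i, D.outer.rowLen i = D.inner.rowLen i + lam.rowLen i) →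
      (∀ i, E.outer.rowLen i = E.inner.rowLen i + lam.rowLen i) → ∀ i,
      (∀ j, D.colAbove (i + 1) j = E.colAbove (i + 1) j) →
      ¬ D.inner.rowLen i < E.inner.rowLen i := by
    intro D E hD hE oD oE i hc hlt
    have h1 := hE.lt_hook (i, D.inner.rowLen i) (YoungDiagram.mem_iff_lt_rowLen.2 hlt)
    rw [E.hookLength_eq, oE, max_eq_right hlt.le, Nat.add_sub_cancel_left, ← hc] at h1
    rcases Nat.eq_zero_or_pos (lam.rowLen i) with h0 | h0
    · have : D.colAbove (i + 1) (D.inner.rowLen i) = 0 := by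
        rw [SkewShape.colAbove, Finset.card_eq_zero, Finset.filter_eq_empty_iff]
        rintro ⟨a, b⟩ h2 ⟨-, h3⟩
        rw [SkewShape.mem_cells_iff, oD] at h2
        have := lam.rowLen_anti i a (by simp only at h3; omega)
        omega
      omega
    · have h2 := hD.hook_le (i, D.inner.rowLen i)
        ((D.mem_cells_iff _ _).2 ⟨le_rfl, by rw [oD]; omega⟩)
      rw [D.hookLength_eq, oD, max_self, Nat.add_sub_cancel_left] at h2
      omega
  have key : ∀ n i, max (D.outer.colLen 0) (E.outer.colLen 0) ≤ i + n →
      D.inner.rowLen i = E.inner.rowLen i ∧ ∀ j, D.colAbove i j = E.colAbove i j := by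
    intro n
    induction n with
    | zero =>
      intro i hi
      refine ⟨?_, fun j => ?_⟩
      · have h1 := YD_rowLen_eq_zero D.outer (i := i) (by omega)
        have h2 := YD_rowLen_eq_zero E.outer (i := i) (by omega)
        have := D.inner_rowLen_le i
        have := E.inner_rowLen_le i
        omega
      · rw [D.colAbove_eq_zero (by omega), E.colAbove_eq_zero (by omega)]
    | succ n ih =>
      intro i hi
      have h1 := (ih (i + 1) (by omega)).2
      have h2 := aux D E hD hE oD oE i h1
      have h3 := aux E D hE hD oE oD i (fun j => (h1 j).symm)
      have h4 : D.inner.rowLen i = E.inner.rowLen i := by omega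
      refine ⟨h4, fun j => ?_⟩
      rw [D.colAbove_succ, E.colAbove_succ, h1, oD, oE, h4]
  have hin : ∀ i, D.inner.rowLen i = E.inner.rowLen i := fun i =>
    (key _ i (Nat.le_add_left _ _)).1
  have e1 : D.inner = E.inner := YD_ext_rowLen hin
  have e2 : D.outer = E.outer := YD_ext_rowLen fun i => by rw [oD, oE, hin]
  cases D
  cases E
  simp only at e1 e2
  subst e1 e2
  rfl

/-- The Young diagram with prescribed row lengths. -/
theorem exists_YD (f : ℕ → ℕ) (hf : Antitone f) (t : ℕ) (ht : ∀ i, t ≤ i → f i = 0) :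
    ∃ μ : YoungDiagram, ∀ i, μ.rowLen i = f i := by
  let μ : YoungDiagram :=
    { cells := (Finset.range t ×ˢ Finset.range (f 0)).filter fun c => c.2 < f c.1
      isLowerSet := by
        rintro ⟨a, b⟩ ⟨c, d⟩ ⟨h1, h2⟩ h3
        simp only [Finset.coe_filter, Finset.mem_product, Finset.mem_range,
          Set.mem_ofPred_eq] at h1 h2 h3 ⊢
        have := hf h1
        omega }
  have hm : ∀ i j, (i, j) ∈ μ ↔ j < f i := by
    intro i j
    rw [← YoungDiagram.mem_cells]
    simp only [μ, Finset.mem_filter, Finset.mem_product, Finset.mem_range]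
    constructor
    · exact fun h => h.2
    · intro h
      refine ⟨⟨?_, h.trans_le (hf (Nat.zero_le i))⟩, h⟩
      by_contra h1
      rw [ht i (by omega)] at h
      omega
  refine ⟨μ, fun i => ?_⟩
  have h1 := hm i (f i)
  have h2 := hm i (μ.rowLen i)
  rw [YoungDiagram.mem_iff_lt_rowLen] at h1 h2
  omega

/-- Rows are added one at a time below the rows already placed, each as far to the left as
possible; `r i` is the resulting indentation of row `i`, and `C i j` the number of cells in
column `j` and rows of index at least `i`. -/
theorem exists_indent (k t : ℕ) : ∀ l : ℕ → ℕ, Antitone l → l 0 ≤ k → (∀ i, t ≤ i → l i = 0) →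
    ∃ (r : ℕ → ℕ) (C : ℕ → ℕ → ℕ), Antitone r ∧ Antitone (fun i => r i + l i) ∧
      (∀ i, t ≤ i → r i = 0) ∧ (∀ i, t ≤ i → ∀ j, C i j = 0) ∧
      (∀ i j, C i j = C (i + 1) j + if r i ≤ j ∧ j < r i + l i then 1 else 0) ∧
      (∀ i, Antitone (C i)) ∧ (∀ i j, C i j ≤ k) ∧ (∀ i j, r i + l i ≤ j → C i j = 0) ∧
      (∀ i j, r i ≤ j → l i + C (i + 1) j ≤ k) ∧ (∀ i j, j < r i → k < l i + C (i + 1) j) := by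
  induction t with
  | zero =>
    intro l hl hk h0
    refine ⟨fun _ => 0, fun _ _ => 0, antitone_const, ?_, by simp, by simp, ?_,
      fun _ => antitone_const, by simp, by simp, ?_, by simp⟩
    · simpa using hl
    · intro i j
      simp [h0 i]
    · intro i j _
      simp [h0 i]
  | succ t ih =>
    intro l hl hk h0
    obtain ⟨r, C, hr, hrl, hr0, hC0, hC, hCa, hCk, hCz, hle, hlt⟩ :=
      ih (fun i => l (i + 1)) (fun a b h => hl (by omega)) ((hl (Nat.zero_le 1)).trans hk)
        (fun i hi => h0 _ (by omega))
    have hex : ∃ j, l 0 + C 0 j ≤ k := ⟨r 0 + l (0 + 1), by rw [hCz 0 _ le_rfl]; omega⟩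
    obtain ⟨s, hs1, hs2⟩ : ∃ s, l 0 + C 0 s ≤ k ∧ ∀ j, j < s → k < l 0 + C 0 j :=
      ⟨Nat.find hex, Nat.find_spec hex, fun j hj => by
        have := Nat.find_min hex hj
        omega⟩
    have hl01 : l 1 ≤ l 0 := hl (Nat.zero_le 1)
    have hsr : r 0 ≤ s := by
      by_contra h
      have h1 := hlt 0 s (by omega)
      have h2 := hC 0 s
      simp only [zero_add] at h1 h2
      omega
    obtain ⟨R, hR0, hRs⟩ : ∃ R : ℕ → ℕ, R 0 = s ∧ ∀ i, R (i + 1) = r i :=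
      ⟨fun i => Nat.casesOn i s r, rfl, fun _ => rfl⟩
    obtain ⟨B, hB0, hBs⟩ : ∃ B : ℕ → ℕ → ℕ,
        (∀ j, B 0 j = C 0 j + if s ≤ j ∧ j < s + l 0 then 1 else 0) ∧
          ∀ i j, B (i + 1) j = C i j :=
      ⟨fun i => Nat.casesOn i (fun j => C 0 j + if s ≤ j ∧ j < s + l 0 then 1 else 0) C,
        fun _ => rfl, fun _ _ => rfl⟩
    refine ⟨R, B, ?_, ?_, ?_, ?_, ?_, ?_, ?_, ?_, ?_, ?_⟩
    · refine antitone_nat_of_succ_le fun i => ?_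
      cases i with
      | zero => rw [hRs, hR0]; exact hsr
      | succ i => rw [hRs, hRs]; exact hr (Nat.le_succ i)
    · refine antitone_nat_of_succ_le fun i => ?_
      cases i with
      | zero =>
        simp only [hRs, hR0, zero_add]
        omega
      | succ i =>
        simp only [hRs]
        exact hrl (Nat.le_succ i)
    · intro i hi
      cases i with
      | zero => omega
      | succ i => rw [hRs]; exact hr0 i (by omega)
    · intro i hi j
      cases i with
      | zero => omega
      | succ i => rw [hBs]; exact hC0 i (by omega) j
    · intro i j
      cases i with
      | zero => rw [hBs, hB0, hR0]
      | succ i => rw [hBs, hBs, hRs]; exact hC i j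
    · intro i a b hab
      cases i with
      | zero =>
        have h1 := hCa 0 hab
        rw [hB0, hB0]
        by_cases ha : a < s
        · have h2 := hs2 a ha
          by_cases hb : b < s
          · rw [if_neg (by omega)]
            omega
          · have h3 := hCa 0 (show s ≤ b by omega)
            split_ifs <;> omega
        · split_ifs <;> omega
      | succ i => rw [hBs, hBs]; exact hCa i hab
    · intro i j
      cases i with
      | zero =>
        rw [hB0]
        have h1 := hCk 0 j
        split_ifs with h
        · have := hCa 0 h.1
          omega
        · omega
      | succ i => rw [hBs]; exact hCk i j
    · intro i j hj
      cases i with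
      | zero =>
        rw [hR0] at hj
        rw [hB0, hCz 0 j (by simp only [zero_add]; omega), if_neg (by omega)]
      | succ i =>
        rw [hRs] at hj
        rw [hBs]
        exact hCz i j hj
    · intro i j hj
      cases i with
      | zero =>
        rw [hR0] at hj
        have := hCa 0 hj
        rw [hBs]
        omega
      | succ i =>
        rw [hRs] at hj
        rw [hBs]
        exact hle i j hj
    · intro i j hj
      cases i with
      | zero =>
        rw [hR0] at hj
        rw [hBs]
        exact hs2 j hj
      | succ i =>
        rw [hRs] at hj
        rw [hBs]
        exact hlt i j hj

theorem exists_kSkew_aux {k : ℕ} (lam : KBounded k) :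
    ∃ D, IsKSkew k lam.diagram D ∧ Antitone D.colLen ∧ (∀ j, D.colLen j ≤ k) ∧
      ∃ t, ∀ j, t ≤ j → D.colLen j = 0 := by
  obtain ⟨r, C, hr, hrl, hr0, hC0, hC, hCa, hCk, hCz, hle, hlt⟩ :=
    exists_indent k (lam.diagram.colLen 0) lam.diagram.rowLen
      (fun a b h => lam.diagram.rowLen_anti a b h) lam.bounded
      (fun i hi => YD_rowLen_eq_zero _ hi)
  obtain ⟨inner, hin⟩ := exists_YD r hr _ hr0
  obtain ⟨outer, hout⟩ := exists_YD _ hrl (lam.diagram.colLen 0) fun i hi => by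
    rw [hr0 i hi, YD_rowLen_eq_zero _ hi]
  have hsub : inner ≤ outer := by
    rintro ⟨i, j⟩ h
    have h1 := YoungDiagram.mem_iff_lt_rowLen.1 h
    refine YoungDiagram.mem_iff_lt_rowLen.2 ?_
    rw [hout]
    rw [hin] at h1
    omega
  let D : SkewShape := ⟨outer, inner, hsub⟩
  have hcol : ∀ i j, D.colAbove i j = C i j :=
    D.colAbove_eq r lam.diagram.rowLen C _ hin hout hC0 hC
  have hin' : ∀ i, D.inner.rowLen i = r i := hin
  have hout' : ∀ i, D.outer.rowLen i = r i + lam.diagram.rowLen i := hout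
  have hcl : D.colLen = C 0 := by
    funext j
    rw [D.colLen_eq_colAbove, hcol]
  refine ⟨D, ⟨?_, ?_, ?_⟩, ?_, ?_, ?_⟩
  · intro i
    rw [D.rowLen_eq_sub, hin', hout', Nat.add_sub_cancel_left]
  · rintro ⟨i, j⟩ h
    rw [D.mem_cells_iff, hin', hout'] at h
    rw [D.hookLength_eq, hcol, hin', hout']
    have := hle i j h.1
    omega
  · rintro ⟨i, j⟩ h
    have h1 := YoungDiagram.mem_iff_lt_rowLen.1 h
    rw [hin'] at h1
    rw [D.hookLength_eq, hcol, hin', hout']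
    have := hlt i j h1
    omega
  · rw [hcl]
    exact hCa 0
  · rw [hcl]
    exact hCk 0
  · rw [hcl]
    exact ⟨_, fun j hj => hCz 0 j hj⟩

/-- Every `k`-bounded partition has exactly one `k`-skew diagram. -/
theorem existsUnique_kSkew {k : ℕ} (lam : KBounded k) : ∃! D, IsKSkew k lam.diagram D := by
  obtain ⟨D, hD, -⟩ := exists_kSkew_aux lam
  exact ⟨D, hD, fun E hE => hE.unique hD⟩

/-- The `k`-skew diagram of a `k`-bounded partition. -/
noncomputable def kSkew {k : ℕ} (lam : KBounded k) : SkewShape := (existsUnique_kSkew lam).choose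

theorem kSkew_spec {k : ℕ} (lam : KBounded k) : IsKSkew k lam.diagram (kSkew lam) :=
  (existsUnique_kSkew lam).choose_spec.1

/-- The columns of the `k`-skew diagram form a `k`-bounded partition. -/
theorem exists_kConj {k : ℕ} (lam : KBounded k) :
    ∃ κ : KBounded k, ∀ j, κ.diagram.rowLen j = (kSkew lam).colLen j := by
  obtain ⟨D, hD, h1, h2, t, h3⟩ := exists_kSkew_aux lam
  obtain ⟨μ, hμ⟩ := exists_YD D.colLen h1 t h3
  rw [(kSkew_spec lam).unique hD]
  exact ⟨⟨μ, by rw [hμ]; exact h2 0⟩, hμ⟩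

/-- The `k`-conjugate: the partition given by the columns of the `k`-skew diagram. -/
noncomputable def kConj {k : ℕ} (lam : KBounded k) : KBounded k := (exists_kConj lam).choose

theorem kConj_spec {k : ℕ} (lam : KBounded k) (j : ℕ) :
    (kConj lam).diagram.rowLen j = (kSkew lam).colLen j :=
  (exists_kConj lam).choose_spec j

/-- The covering relation of the Young order: `mu ⊆ lam`, and they differ by one box. -/
def YoungCover (mu lam : YoungDiagram) : Prop := mu ≤ lam ∧ lam.card = mu.card + 1

/-- The relation generating the `k`-order: `mu ⊆ lam`, the same inclusion of the `k`-conjugates,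
and `|lam| - |mu| = 1`. -/
def KCover {k : ℕ} (mu lam : KBounded k) : Prop :=
  mu.diagram ≤ lam.diagram ∧ (kConj mu).diagram ≤ (kConj lam).diagram ∧
    lam.diagram.card = mu.diagram.card + 1

theorem diagram_le_of_reflTransGen {k : ℕ} {mu lam : KBounded k}
    (h : Relation.ReflTransGen KCover mu lam) : mu.diagram ≤ lam.diagram := by
  induction h with
  | refl => exact le_rfl
  | tail _ h ih => exact ih.trans h.1

/-- The `k`-Young lattice: `k`-bounded partitions under the reflexive and transitive closure
of `KCover`. -/
instance instPartialOrderKBounded (k : ℕ) : PartialOrder (KBounded k) where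
  le mu lam := Relation.ReflTransGen KCover mu lam
  le_refl _ := Relation.ReflTransGen.refl
  le_trans _ _ _ h1 h2 := h1.trans h2
  le_antisymm _ _ h1 h2 :=
    KBounded.ext (le_antisymm (diagram_le_of_reflTransGen h1) (diagram_le_of_reflTransGen h2))

/-- The rectangular partition `(m^n)`, with `n` parts equal to `m`. -/
def rect (m n : ℕ) : YoungDiagram where
  cells := Finset.range n ×ˢ Finset.range m
  isLowerSet := by
    rintro ⟨a, b⟩ ⟨c, d⟩ ⟨h1, h2⟩ h3
    simp only [Finset.coe_product, Finset.coe_range, Set.mem_prod, Set.mem_Iio] at h1 h2 h3 ⊢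
    omega

theorem rect_bounded {k m : ℕ} (n : ℕ) (h : m ≤ k) : (rect m n).rowLen 0 ≤ k := by
  by_contra h1
  have h2 : (0, k) ∈ rect m n := YoungDiagram.mem_iff_lt_rowLen.2 (by omega)
  rw [← YoungDiagram.mem_cells] at h2
  simp only [rect, Finset.mem_product, Finset.mem_range] at h2
  omega

/-- `L(m,n)`, the principal order ideal generated by `(m^n)` in the Young lattice. -/
def L (m n : ℕ) : Set YoungDiagram := Set.Iic (rect m n)

/-- `L^k(m,n)`, the principal order ideal generated by `(m^n)` in the `k`-Young lattice. -/
def Lk {k m : ℕ} (h : m ≤ k) (n : ℕ) : Set (KBounded k) := Set.Iic ⟨rect m n, rect_bounded n h⟩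

end KYoung

/-!
Put `h = k + 1 - m`.  The argument rests on the set of partitions with parts at most `m` and with
at most `h` nonzero parts smaller than `m` (`KYoung.FewSmallParts`).

For such a partition `lam` the `k`-skew diagram can be computed.  The rows shorter than `m` are not
indented at all, and then every row of length `m` is put on the leftmost `m` columns that contain
fewer than `h` cells.  Hence each row of length `m` adds one cell to every residue class of columns
modulo `m`, and the class of `p < m` consists of the `lam.colLen p` cells of column `p`, cut into
pieces of size `h` that stand in the columns `p`, `p + m`, `p + 2 * m` and so on
(`KYoung.FewSmallParts.kConj_rowLen`).  This description is monotone in `lam`, so that between two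
such partitions inclusion of diagrams implies inclusion of the `k`-conjugates.

The set is closed downwards in the `k`-order (`KYoung.FewSmallParts.of_kCover`): if a partition has
more than `h` nonzero parts smaller than `m`, its top `h + 1` rows are not indented, and the first
column of its `k`-skew diagram has more than `h` cells, whereas it has at most `h` cells for a
member of the set.  As the rectangle is a member, so is all of `L^k(m,n)`.  Finally, if `mu < lam`
are members, then removing the last cell of the highest row in which they differ leaves a member
that contains `mu` (`KYoung.FewSmallParts.exists_remove`), so inclusions are chains of covers.
-/

namespace KYoung

/-! ### Row and column lengths -/

theorem lt_rowLen_iff_lt_colLen (lam : YoungDiagram) (i j : ℕ) :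
    j < lam.rowLen i ↔ i < lam.colLen j := by
  rw [← YoungDiagram.mem_iff_lt_rowLen, YoungDiagram.mem_iff_lt_colLen]

theorem rowLen_mono {mu lam : YoungDiagram} (h : mu ≤ lam) (i : ℕ) :
    mu.rowLen i ≤ lam.rowLen i := by
  by_contra! hlt
  exact lt_irrefl _ (YoungDiagram.mem_iff_lt_rowLen.1 (h (YoungDiagram.mem_iff_lt_rowLen.2 hlt)))

theorem le_of_rowLen_le {mu lam : YoungDiagram} (h : ∀ i, mu.rowLen i ≤ lam.rowLen i) :
    mu ≤ lam := by
  rintro ⟨i, j⟩ hij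
  exact YoungDiagram.mem_iff_lt_rowLen.2 ((YoungDiagram.mem_iff_lt_rowLen.1 hij).trans_le (h i))

theorem colLen_mono {mu lam : YoungDiagram} (h : mu ≤ lam) (j : ℕ) :
    mu.colLen j ≤ lam.colLen j := by
  by_contra! hlt
  exact lt_irrefl _ (YoungDiagram.mem_iff_lt_colLen.1 (h (YoungDiagram.mem_iff_lt_colLen.2 hlt)))

theorem card_lt_card_of_lt {mu lam : YoungDiagram} (h : mu < lam) : mu.card < lam.card :=
  Finset.card_lt_card (YoungDiagram.cells_ssubset_iff.2 h)

theorem covBy_of_card_eq_succ {mu lam : YoungDiagram} (hcard : lam.card = mu.card + 1)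
    (h : mu < lam) : mu ⋖ lam := by
  refine ⟨h, fun nu h1 h2 => ?_⟩
  have := card_lt_card_of_lt h1
  have := card_lt_card_of_lt h2
  omega

/-! ### The `k`-skew diagram row by row -/

namespace IsKSkew

variable {k : ℕ} {lam : YoungDiagram} {D : SkewShape}

theorem outer_rowLen (hD : IsKSkew k lam D) (i : ℕ) :
    D.outer.rowLen i = D.inner.rowLen i + lam.rowLen i := by
  have h1 := D.inner_rowLen_le i
  have h2 := hD.rowLen_eq i
  rw [D.rowLen_eq_sub] at h2
  omega

theorem lt_of_lt_inner (hD : IsKSkew k lam D) {i j : ℕ} (hj : j < D.inner.rowLen i) :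
    k < lam.rowLen i + D.colAbove (i + 1) j := by
  have h1 := hD.lt_hook (i, j) (YoungDiagram.mem_iff_lt_rowLen.2 hj)
  rwa [D.hookLength_eq, hD.outer_rowLen, max_eq_right hj.le, Nat.add_sub_cancel_left] at h1

theorem le_at_inner (hD : IsKSkew k lam D) {i : ℕ} (hi : 0 < lam.rowLen i) :
    lam.rowLen i + D.colAbove (i + 1) (D.inner.rowLen i) ≤ k := by
  have h1 := hD.hook_le (i, D.inner.rowLen i)
    ((D.mem_cells_iff _ _).2 ⟨le_rfl, by rw [hD.outer_rowLen]; omega⟩)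
  rwa [D.hookLength_eq, hD.outer_rowLen, max_self, Nat.add_sub_cancel_left] at h1

theorem colAbove_succ (hD : IsKSkew k lam D) (i j : ℕ) :
    D.colAbove i j = D.colAbove (i + 1) j +
      if D.inner.rowLen i ≤ j ∧ j < D.inner.rowLen i + lam.rowLen i then 1 else 0 := by
  rw [D.colAbove_succ, hD.outer_rowLen]

theorem colAbove_eq_zero (hD : IsKSkew k lam D) {i : ℕ} (hi : lam.colLen 0 ≤ i) (j : ℕ) :
    D.colAbove i j = 0 := by
  rw [SkewShape.colAbove, Finset.card_eq_zero, Finset.filter_eq_empty_iff]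
  rintro ⟨a, b⟩ h1 ⟨-, h2⟩
  rw [SkewShape.mem_cells_iff, hD.outer_rowLen,
    YD_rowLen_eq_zero lam (hi.trans h2)] at h1
  omega

/-- Downward induction on the rows: a property of the column lengths above row `i` holds for all
`i ≥ b` if it holds where there are no cells and is passed from row `i + 1` to row `i`. -/
theorem descend (hD : IsKSkew k lam D) {P : ℕ → (ℕ → ℕ) → Prop} (b : ℕ)
    (h0 : ∀ i, lam.colLen 0 ≤ i → P i fun _ => 0)
    (hs : ∀ i, b ≤ i → i < lam.colLen 0 → P (i + 1) (D.colAbove (i + 1)) → P i (D.colAbove i))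
    (i : ℕ) (hi : b ≤ i) : P i (D.colAbove i) := by
  obtain ⟨n, hn⟩ : ∃ n, lam.colLen 0 ≤ i + n := ⟨_, Nat.le_add_left _ _⟩
  induction n generalizing i with
  | zero =>
    rw [show D.colAbove i = fun _ => 0 from funext fun j => hD.colAbove_eq_zero hn j]
    exact h0 i hn
  | succ n ih =>
    by_cases h : lam.colLen 0 ≤ i
    · rw [show D.colAbove i = fun _ => 0 from funext fun j => hD.colAbove_eq_zero h j]
      exact h0 i h
    · exact hs i hi (by omega) (ih (i + 1) (by omega) (by omega))

end IsKSkew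

/-! ### Partitions with few small parts -/

/-- All parts of `lam` are at most `m`, and at most `h` of its nonzero parts are smaller than `m`.
The number of nonzero parts smaller than `m` is the difference of the lengths of the columns `0`
and `m - 1`; for `m = 0` only the empty partition qualifies. -/
structure FewSmallParts (m h : ℕ) (lam : YoungDiagram) : Prop where
  rowLen_le : lam.rowLen 0 ≤ m
  colLen_le : lam.colLen 0 ≤ lam.colLen (m - 1) + h

/-- Column `p` of `lam`, for `p < m`, without its lowest `i` cells, is cut into pieces of size `h`;
the value at `j` is the size of piece number `j / m` of column `p = j % m`. -/
def foldedCol (m h : ℕ) (lam : YoungDiagram) (i j : ℕ) : ℕ :=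
  min h (lam.colLen (j % m) - i - j / m * h)

namespace FewSmallParts

variable {k m h : ℕ} {lam : YoungDiagram}

theorem rowLen_le' (hl : FewSmallParts m h lam) (i : ℕ) : lam.rowLen i ≤ m :=
  (lam.rowLen_anti 0 i (Nat.zero_le i)).trans hl.rowLen_le

theorem colLen_zero_le_mod (hl : FewSmallParts m h lam) (j : ℕ) :
    lam.colLen 0 ≤ lam.colLen (j % m) + h := by
  rcases Nat.eq_zero_or_pos m with rfl | hm
  · have : ¬ 0 < lam.rowLen 0 := by have := hl.rowLen_le; omega
    rw [lt_rowLen_iff_lt_colLen] at this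
    omega
  · have h1 := lam.colLen_anti (j % m) (m - 1) (by have := Nat.mod_lt j hm; omega)
    have := hl.colLen_le
    omega

/-- The pieces of the columns decrease along `p < m` for each fixed index of the piece, and from
one index to the next because column `m - 1` is at most `h` cells shorter than column `0`. -/
theorem foldedCol_antitone (hl : FewSmallParts m h lam) (i : ℕ) :
    Antitone (foldedCol m h lam i) := by
  intro a b hab
  have hdiv : a / m ≤ b / m := Nat.div_le_div_right hab
  unfold foldedCol
  rcases hdiv.eq_or_lt with heq | hlt
  · have hmod : a % m ≤ b % m := by
      have h1 := Nat.div_add_mod a m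
      have h2 := Nat.div_add_mod b m
      rw [heq] at h1
      omega
    have := lam.colLen_anti _ _ hmod
    rw [heq]
    omega
  · have h1 : (a / m + 1) * h ≤ b / m * h := Nat.mul_le_mul_right h hlt
    rw [add_mul, one_mul] at h1
    have h2 := lam.colLen_anti 0 (b % m) (Nat.zero_le _)
    have h3 := hl.colLen_zero_le_mod a
    omega

/-- A row of length `m` put on the leftmost `m` columns with fewer than `h` cells extends
the last piece of every column by one cell. -/
theorem foldedCol_of_full_row (hl : FewSmallParts m h lam) (hm : 0 < m) (hh : 0 < h) {i r : ℕ}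
    (hi : lam.rowLen i = m) (hr : foldedCol m h lam (i + 1) r < h)
    (hlt : ∀ j < r, foldedCol m h lam (i + 1) j = h) (j : ℕ) :
    foldedCol m h lam i j =
      foldedCol m h lam (i + 1) j + if r ≤ j ∧ j < r + m then 1 else 0 := by
  have hcol : i < lam.colLen (j % m) := by
    rw [← lt_rowLen_iff_lt_colLen, hi]
    exact Nat.mod_lt j hm
  -- the preceding column of the same residue class
  have hprev : m ≤ j → foldedCol m h lam (i + 1) (j - m) =
      min h (lam.colLen (j % m) - (i + 1) - (j / m - 1) * h) ∧ j / m * h = (j / m - 1) * h + h := by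
    intro hmj
    constructor
    · rw [foldedCol, ← Nat.mod_eq_sub_mod hmj]
      rw [Nat.div_eq_sub_div hm hmj]
      simp
    · have : 0 < j / m := Nat.div_pos hmj hm
      obtain ⟨q, hq⟩ : ∃ q, j / m = q + 1 := ⟨j / m - 1, by omega⟩
      rw [hq, Nat.add_sub_cancel, add_mul, one_mul]
  rcases lt_or_ge j r with hjr | hjr
  -- left of the new row every column already has `h` cells
  · have h1 := hlt j hjr
    rw [if_neg (by omega), h1]
    unfold foldedCol at h1 ⊢
    omega
  · have h1 := (hl.foldedCol_antitone (i + 1) hjr).trans_lt hr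
    rcases lt_or_ge j (r + m) with hjm | hjm
    -- under the new row the preceding piece is complete and this one is not
    · rw [if_pos ⟨hjr, hjm⟩]
      rcases lt_or_ge j m with hj | hj
      · unfold foldedCol at h1 ⊢
        rw [Nat.div_eq_of_lt hj] at h1 ⊢
        omega
      · have h2 := hlt (j - m) (by omega)
        rw [(hprev hj).1] at h2
        have h3 := (hprev hj).2
        unfold foldedCol at h1 ⊢
        omega
    -- right of the new row the preceding piece is incomplete, so this one is empty
    · rw [if_neg (by omega)]
      have h2 := (hl.foldedCol_antitone (i + 1) (show r ≤ j - m by omega)).trans_lt hr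
      rw [(hprev (by omega)).1] at h2
      have h3 := (hprev (by omega)).2
      unfold foldedCol
      omega

/-- In a row shorter than `m` the cell of column `j` is a new lowest cell of the first piece. -/
theorem foldedCol_of_short_row (hl : FewSmallParts m h lam) {i : ℕ} (hi : lam.rowLen i < m)
    (j : ℕ) : foldedCol m h lam i j =
      foldedCol m h lam (i + 1) j + if j < lam.rowLen i then 1 else 0 := by
  have h1 : ¬ m - 1 < lam.rowLen i := by omega
  rw [lt_rowLen_iff_lt_colLen] at h1
  have h2 := hl.colLen_le
  have h3 := lam.colLen_anti 0 (j % m) (Nat.zero_le _)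
  unfold foldedCol
  rcases lt_or_ge j m with hj | hj
  · rw [Nat.div_eq_of_lt hj, Nat.mod_eq_of_lt hj] at *
    have h4 := lt_rowLen_iff_lt_colLen lam i j
    split_ifs <;> omega
  · have h4 : 1 * h ≤ j / m * h := Nat.mul_le_mul_right h (Nat.div_pos hj (by omega))
    rw [if_neg (by omega)]
    omega

theorem colAbove_eq_foldedCol (hl : FewSmallParts m h lam) (hmk : h + m = k + 1) (hh : 0 < h)
    {D : SkewShape} (hD : IsKSkew k lam D) (i j : ℕ) :
    D.colAbove i j = foldedCol m h lam i j := by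
  refine hD.descend (P := fun i C => ∀ j, C j = foldedCol m h lam i j) 0 ?_ ?_ i (Nat.zero_le i) j
  · intro i hi j
    have := lam.colLen_anti 0 (j % m) (Nat.zero_le _)
    change 0 = foldedCol m h lam i j
    unfold foldedCol
    omega
  · intro i _ hi ih j
    rw [← lt_rowLen_iff_lt_colLen] at hi
    rw [hD.colAbove_succ, ih]
    rcases (hl.rowLen_le' i).eq_or_lt with him | him
    · have hr := hD.le_at_inner hi
      rw [ih] at hr
      rw [hl.foldedCol_of_full_row (r := D.inner.rowLen i) (by omega) hh him (by omega)
        (fun j hj => ?_), him]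
      have h1 := hD.lt_of_lt_inner hj
      rw [ih] at h1
      have h2 : foldedCol m h lam (i + 1) j ≤ h := min_le_left _ _
      omega
    -- an indented row of length less than `m` would need `k < (m - 1) + h = k`
    · have hr : D.inner.rowLen i = 0 := by
        by_contra hne
        have h1 := hD.lt_of_lt_inner (Nat.pos_of_ne_zero hne)
        rw [ih] at h1
        have h2 : foldedCol m h lam (i + 1) 0 ≤ h := min_le_left _ _
        omega
      rw [hl.foldedCol_of_short_row him, hr, zero_add]
      simp

/-- The `k`-conjugate of a partition with few small parts: its columns, cut into pieces of
size `h` and arranged by the index of the piece. -/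
theorem kConj_rowLen {lam : KBounded k} (hl : FewSmallParts m h lam.diagram)
    (hmk : h + m = k + 1) (hh : 0 < h) (j : ℕ) :
    (kConj lam).diagram.rowLen j = foldedCol m h lam.diagram 0 j := by
  rw [kConj_spec, SkewShape.colLen_eq_colAbove,
    hl.colAbove_eq_foldedCol hmk hh (kSkew_spec lam)]

theorem kConj_le {mu lam : KBounded k} (hm : FewSmallParts m h mu.diagram)
    (hl : FewSmallParts m h lam.diagram) (hmk : h + m = k + 1) (hh : 0 < h)
    (hle : mu.diagram ≤ lam.diagram) : (kConj mu).diagram ≤ (kConj lam).diagram := by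
  refine le_of_rowLen_le fun j => ?_
  rw [hm.kConj_rowLen hmk hh, hl.kConj_rowLen hmk hh]
  have := colLen_mono hle (j % m)
  unfold foldedCol
  omega

end FewSmallParts

/-! ### Closure under the `k`-order -/

/-- The top `h + 1` rows of a partition with more than `h` nonzero parts smaller than `m`
are not indented in the `k`-skew diagram, hence contribute `h + 1` cells to its first column. -/
theorem lt_kConj_rowLen_zero {k m h : ℕ} {mu : KBounded k} (hmk : h + m = k + 1)
    (hmu : mu.diagram.colLen (m - 1) + h < mu.diagram.colLen 0) :
    h < (kConj mu).diagram.rowLen 0 := by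
  rw [kConj_spec, SkewShape.colLen_eq_colAbove]
  have hD := kSkew_spec mu
  generalize kSkew mu = D at hD ⊢
  obtain ⟨b, hb⟩ : ∃ b, b = mu.diagram.colLen 0 - (h + 1) := ⟨_, rfl⟩
  have key : D.colAbove b 0 = mu.diagram.colLen 0 - b := by
    refine hD.descend (P := fun i C => C 0 = mu.diagram.colLen 0 - i) b ?_ ?_ b le_rfl
    · intro i hi
      exact (Nat.sub_eq_zero_of_le hi).symm
    · intro i hbi hi ih
      have hpos := (lt_rowLen_iff_lt_colLen mu.diagram i 0).2 hi
      have hshort : ¬ m - 1 < mu.diagram.rowLen i := by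
        rw [lt_rowLen_iff_lt_colLen]
        omega
      -- at most `h` rows lie above row `i ≥ b`, and `(m - 1) + h = k`
      have hr : D.inner.rowLen i = 0 := by
        by_contra hne
        have h1 := hD.lt_of_lt_inner (Nat.pos_of_ne_zero hne)
        omega
      rw [hD.colAbove_succ, hr, ih, if_pos (by omega)]
      omega
  have hmono : D.colAbove b 0 ≤ D.colAbove 0 0 := by
    refine Finset.card_le_card (Finset.monotone_filter_right _ ?_)
    rintro c - ⟨h1, -⟩
    exact ⟨h1, Nat.zero_le _⟩
  omega

namespace FewSmallParts

variable {k m h : ℕ}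

theorem of_kCover {mu lam : KBounded k} (hl : FewSmallParts m h lam.diagram)
    (hmk : h + m = k + 1) (hh : 0 < h) (hc : KCover mu lam) : FewSmallParts m h mu.diagram := by
  refine ⟨(rowLen_mono hc.1 0).trans hl.rowLen_le, ?_⟩
  by_contra! hlt
  have h1 := lt_kConj_rowLen_zero hmk hlt
  have h2 := rowLen_mono hc.2.1 0
  rw [hl.kConj_rowLen hmk hh] at h2
  have h3 : foldedCol m h lam.diagram 0 0 ≤ h := min_le_left _ _
  omega

theorem of_le {mu lam : KBounded k} (hl : FewSmallParts m h lam.diagram)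
    (hmk : h + m = k + 1) (hh : 0 < h) (hle : mu ≤ lam) : FewSmallParts m h mu.diagram := by
  change Relation.ReflTransGen KCover mu lam at hle
  induction hle using Relation.ReflTransGen.head_induction_on with
  | refl => exact hl
  | head hc _ ih => exact ih.of_kCover hmk hh hc

theorem rect (m h n : ℕ) : FewSmallParts m h (rect m n) := by
  have hrow : ∀ i j, j < (KYoung.rect m n).rowLen i ↔ i < n ∧ j < m := by
    intro i j
    rw [← YoungDiagram.mem_iff_lt_rowLen, ← YoungDiagram.mem_cells]
    simp [KYoung.rect]
  refine ⟨?_, ?_⟩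
  · by_contra! hlt
    have := (hrow 0 m).1 hlt
    omega
  · by_contra! hlt
    have h1 := (hrow ((KYoung.rect m n).colLen (m - 1)) 0).1
      ((lt_rowLen_iff_lt_colLen _ _ _).2 (by omega))
    have h2 := (lt_rowLen_iff_lt_colLen _ _ _).1
      ((hrow ((KYoung.rect m n).colLen (m - 1)) (m - 1)).2 ⟨h1.1, by omega⟩)
    omega

/-! ### Removing a cell -/

/-- The removed cell is the last one of the highest row in which `mu` and `lam` differ.  If this
row has length `m`, the rows above it are those of `mu`, so that the number of small parts is at
most that of `mu`, or at most one. -/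
theorem exists_remove (hh : 0 < h) {mu lam : YoungDiagram} (hm : FewSmallParts m h mu)
    (hl : FewSmallParts m h lam) (hlt : mu < lam) :
    ∃ nu, FewSmallParts m h nu ∧ mu ≤ nu ∧ nu ≤ lam ∧ lam.card = nu.card + 1 := by
  have hmono := rowLen_mono hlt.le
  obtain ⟨i, hi, hmax⟩ : ∃ i, mu.rowLen i < lam.rowLen i ∧
      ∀ i', i < i' → mu.rowLen i' = lam.rowLen i' := by
    have hex : ∃ b, ∀ i, b ≤ i → mu.rowLen i = lam.rowLen i :=
      ⟨lam.colLen 0, fun i hi => by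
        have h1 := YD_rowLen_eq_zero lam hi
        have h2 := hmono i
        omega⟩
    obtain ⟨b, hb, hbmin⟩ : ∃ b, (∀ i, b ≤ i → mu.rowLen i = lam.rowLen i) ∧
        ∀ c < b, ¬ ∀ i, c ≤ i → mu.rowLen i = lam.rowLen i := by
      classical
      exact ⟨Nat.find hex, Nat.find_spec hex, fun c hc => Nat.find_min hex hc⟩
    obtain _ | c := b
    · exact absurd (YD_ext_rowLen fun i => hb i (Nat.zero_le i)) hlt.ne
    · refine ⟨c, lt_of_le_of_ne (hmono c) fun heq => ?_, fun i' hi' => hb i' hi'⟩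
      refine hbmin c (Nat.lt_succ_self c) fun i hi => ?_
      rcases hi.eq_or_lt with rfl | hi
      · exact heq
      · exact hb i hi
  have hcorner : (i, lam.rowLen i - 1) ∈ lam :=
    YoungDiagram.mem_iff_lt_rowLen.2 (by omega)
  let nu : YoungDiagram :=
    { cells := lam.cells.erase (i, lam.rowLen i - 1)
      isLowerSet := by
        rintro ⟨a, b⟩ ⟨c, d⟩ ⟨h1, h2⟩ h3
        simp only [Finset.coe_erase, Set.mem_sdiff, Finset.mem_coe, YoungDiagram.mem_cells,
          Set.mem_singleton_iff, Prod.mk.injEq, YoungDiagram.mem_iff_lt_rowLen] at h1 h2 h3 ⊢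
        have h4 := lam.rowLen_anti c a h1
        refine ⟨by omega, ?_⟩
        rintro ⟨rfl, rfl⟩
        rcases h1.eq_or_lt with rfl | h1
        · omega
        · have h5 := hmax a h1
          have h6 := mu.rowLen_anti c a h1.le
          omega }
  have hmem : ∀ a b, (a, b) ∈ nu ↔ (a, b) ∈ lam ∧ ¬ (a = i ∧ b = lam.rowLen i - 1) := by
    intro a b
    rw [← YoungDiagram.mem_cells]
    simp [nu, and_comm]
  have hnl : nu ≤ lam := fun c hc => ((hmem c.1 c.2).1 hc).1
  refine ⟨nu, ⟨(rowLen_mono hnl 0).trans hl.rowLen_le, ?_⟩, ?_, hnl, ?_⟩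
  · have h1 := colLen_mono hnl 0
    by_cases hc : lam.rowLen i - 1 = m - 1
    · -- rows below `i` keep their cell in column `m - 1`
      have h2 : i ≤ nu.colLen (m - 1) := by
        by_contra! hn
        refine lt_irrefl _ (YoungDiagram.mem_iff_lt_colLen.1
          ((hmem (nu.colLen (m - 1)) (m - 1)).2 ⟨?_, by omega⟩))
        have := lam.rowLen_anti _ _ hn.le
        exact YoungDiagram.mem_iff_lt_rowLen.2 (by omega)
      have h3 : ¬ m - 1 < mu.rowLen i := by omega
      rw [lt_rowLen_iff_lt_colLen] at h3
      have h4 := hm.colLen_le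
      have h5 : lam.colLen 0 ≤ max (i + 1) (mu.colLen 0) := by
        by_contra! hn
        have h6 := (lt_rowLen_iff_lt_colLen lam _ 0).2 hn
        rw [← hmax _ (by omega), lt_rowLen_iff_lt_colLen] at h6
        omega
      omega
    · have h2 : lam.colLen (m - 1) ≤ nu.colLen (m - 1) := by
        by_contra! hn
        refine lt_irrefl _ (YoungDiagram.mem_iff_lt_colLen.1
          ((hmem (nu.colLen (m - 1)) (m - 1)).2 ⟨YoungDiagram.mem_iff_lt_colLen.2 hn, by omega⟩))
      have := hl.colLen_le
      omega
  · rintro ⟨a, b⟩ hab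
    refine (hmem a b).2 ⟨hlt.le hab, ?_⟩
    rintro ⟨rfl, rfl⟩
    have := YoungDiagram.mem_iff_lt_rowLen.1 hab
    omega
  · have h1 := Finset.card_erase_add_one ((YoungDiagram.mem_cells _).2 hcorner)
    exact h1.symm

theorem kCover_iff {mu lam : KBounded k} (hm : FewSmallParts m h mu.diagram)
    (hl : FewSmallParts m h lam.diagram) (hmk : h + m = k + 1) (hh : 0 < h) :
    KCover mu lam ↔ YoungCover mu.diagram lam.diagram :=
  ⟨fun hc => ⟨hc.1, hc.2.2⟩, fun hc => ⟨hc.1, hm.kConj_le hl hmk hh hc.1, hc.2⟩⟩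

theorem exists_kCover {mu lam : KBounded k} (hm : FewSmallParts m h mu.diagram)
    (hl : FewSmallParts m h lam.diagram) (hmk : h + m = k + 1) (hh : 0 < h)
    (hlt : mu.diagram < lam.diagram) :
    ∃ nu : KBounded k, FewSmallParts m h nu.diagram ∧ mu.diagram ≤ nu.diagram ∧
      KCover nu lam := by
  obtain ⟨nu, hn, hmn, hnl, hcard⟩ := exists_remove hh hm hl hlt
  let nu' : KBounded k := ⟨nu, (rowLen_mono hnl 0).trans lam.bounded⟩
  have hn' : FewSmallParts m h nu'.diagram := hn
  exact ⟨nu', hn', hmn, (hn'.kCover_iff hl hmk hh).2 ⟨hnl, hcard⟩⟩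

theorem le_iff {mu lam : KBounded k} (hm : FewSmallParts m h mu.diagram)
    (hl : FewSmallParts m h lam.diagram) (hmk : h + m = k + 1) (hh : 0 < h) :
    mu ≤ lam ↔ mu.diagram ≤ lam.diagram := by
  refine ⟨diagram_le_of_reflTransGen, fun hle => ?_⟩
  induction hc : lam.diagram.card using Nat.strong_induction_on generalizing lam with
  | _ c ih =>
    rcases hle.eq_or_lt with heq | hlt
    · exact (KBounded.ext heq).le
    · obtain ⟨nu, hn, hmn, hcov⟩ := hm.exists_kCover hl hmk hh hlt
      have h1 : mu ≤ nu := ih nu.diagram.card (by have := hcov.2.2; omega) hn hmn rfl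
      exact Relation.ReflTransGen.tail h1 hcov

end FewSmallParts

/-! ### The order ideal of a rectangle -/

theorem fewSmallParts_of_mem_Lk {k m n : ℕ} (hmk : m ≤ k) {lam : KBounded k}
    (hl : lam ∈ Lk hmk n) : FewSmallParts m (k + 1 - m) lam.diagram :=
  FewSmallParts.of_le (lam := ⟨rect m n, rect_bounded n hmk⟩) (FewSmallParts.rect m _ n)
    (by omega) (by omega) hl

end KYoung

theorem mainTheorem3 {k m : ℕ} (hmk : m ≤ k) (n : ℕ) :
    -- on `L^k(m,n)` the `k`-order is inclusion of diagrams
    (∀ lam ∈ KYoung.Lk hmk n, ∀ mu ∈ KYoung.Lk hmk n,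
      (mu ≤ lam ↔ mu.diagram ≤ lam.diagram)) ∧
    -- `L^k(m,n)` is isomorphic, identically on partitions, to the subposet of `L(m,n)` induced
    -- on the partitions in `L^k(m,n)`
    (∃ e : ↥(KYoung.Lk hmk n) ≃o
        {nu : ↥(KYoung.L m n) // (nu : YoungDiagram) ∈ KYoung.KBounded.diagram '' KYoung.Lk hmk n},
      ∀ lam, ((e lam : ↥(KYoung.L m n)) : YoungDiagram) = (lam : KYoung.KBounded k).diagram) ∧
    -- the generating covering relations coincide on `L^k(m,n)`
    (∀ lam ∈ KYoung.Lk hmk n, ∀ mu ∈ KYoung.Lk hmk n,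
      (KYoung.KCover mu lam ↔ KYoung.YoungCover mu.diagram lam.diagram)) ∧
    -- the covers of the poset `L^k(m,n)` are those of the Young lattice
    (∀ lam mu : ↥(KYoung.Lk hmk n),
      (mu ⋖ lam ↔ (mu : KYoung.KBounded k).diagram ⋖ (lam : KYoung.KBounded k).diagram)) := by

  have key := fun (lam : KYoung.KBounded k) (hl : lam ∈ KYoung.Lk hmk n) =>
    KYoung.fewSmallParts_of_mem_Lk hmk hl
  have hk : k + 1 - m + m = k + 1 := by omega
  have hh : 0 < k + 1 - m := by omega
  have hle : ∀ lam ∈ KYoung.Lk hmk n, ∀ mu ∈ KYoung.Lk hmk n,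
      (mu ≤ lam ↔ mu.diagram ≤ lam.diagram) :=
    fun lam hl mu hm => (key mu hm).le_iff (key lam hl) hk hh
  refine ⟨hle, ?_, fun lam hl mu hm => (key mu hm).kCover_iff (key lam hl) hk hh, ?_⟩
  · let f : ↥(KYoung.Lk hmk n) → {nu : ↥(KYoung.L m n) //
        (nu : YoungDiagram) ∈ KYoung.KBounded.diagram '' KYoung.Lk hmk n} := fun lam =>
      ⟨⟨lam.1.diagram, KYoung.diagram_le_of_reflTransGen lam.2⟩, lam.1, lam.2, rfl⟩
    have hf : ∀ a b, f a ≤ f b ↔ a ≤ b := fun a b => (hle b.1 b.2 a.1 a.2).symm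
    have hsurj : Function.Surjective f := by
      rintro ⟨nu, lam, hlam, heq⟩
      exact ⟨⟨lam, hlam⟩, Subtype.ext (Subtype.ext heq)⟩
    exact ⟨RelIso.ofSurjective (OrderEmbedding.ofMapLEIff f hf) hsurj, fun lam => rfl⟩
  · rintro ⟨lam, hl⟩ ⟨mu, hm⟩
    have hlt : ∀ a b : ↥(KYoung.Lk hmk n), a < b ↔ a.1.diagram < b.1.diagram := fun a b =>
      lt_iff_lt_of_le_iff_le' (hle a.1 a.2 b.1 b.2) (hle b.1 b.2 a.1 a.2)
    constructor
    · intro hcov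
      have h1 : mu.diagram < lam.diagram := (hlt _ _).1 hcov.lt
      obtain ⟨nu, -, hmn, hc⟩ := (key mu hm).exists_kCover (key lam hl) hk hh h1
      have hnl : nu ≤ lam := Relation.ReflTransGen.single hc
      have hn : nu ∈ KYoung.Lk hmk n := hnl.trans hl
      rcases hmn.eq_or_lt with heq | hlt'
      · exact KYoung.covBy_of_card_eq_succ (heq ▸ hc.2.2) h1
      · have hcard := hc.2.2
        have h2 : nu.diagram < lam.diagram := lt_of_le_of_ne hc.1 fun he => by
          rw [he] at hcard
          omega
        exact absurd ((hlt ⟨nu, hn⟩ ⟨lam, hl⟩).2 h2) (hcov.2 ((hlt ⟨mu, hm⟩ ⟨nu, hn⟩).2 hlt'))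
    · intro hcov
      exact ⟨(hlt _ _).2 hcov.lt, fun nu h1 h2 => hcov.2 ((hlt _ _).1 h1) ((hlt _ _).1 h2)⟩
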